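/- Let $k$ be a commutative ring and let $\mathsf C$ be a $k$-linear abelian category in which every object has finite length, every morphism set has finite length as a $k$-module, and there are only finitely many isomorphism classes of simple objects. A character for $\mathsf C$ is a function $\chi\colon \operatorname{Ob}\mathsf C\to\mathbb N$ (with $0\in\mathbb N$) such that $\chi(X\oplus Y)=\chi(X)+\chi(Y)$ for all objects $X,Y$, and $\chi(Y)\le \chi(X)+\chi(Z)$ for each exact sequence $X\to Y\to Z\to 0$. A character is irreducible if it is non-zero and is not a sum of two non-zero characters. Let $\operatorname{Sp}\mathsf C$ be the set of irreducible characters, endowed with the topology generated by the sets $$\mathsf U_\alpha=\{\chi\in\operatorname{Sp}\mathsf C\mid \chi(X)-\chi(Y)+\chi(\operatorname{Coker}\alpha)\neq 0\},$$ where $\alpha\colon X\to Y$ runs through all morphisms in $\mathsf C$. For an object $M$ of $\mathsf C$, put $\chi_M(X)=\operatorname{length}_{\operatorname{End}(M)}\operatorname{Hom}(X,M)$. A morphism $\phi\colon M\to N$ in $\mathsf C$ is left almost split if it is not a split monomorphism and every morphism $M\to N'$ in $\mathsf C$ that is not a split monomorphism factors through $\phi$. Let $\chi\in\operatorname{Sp}\mathsf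 C$. Then $\{\chi\}$ is open in $\operatorname{Sp}\mathsf C$ if and only if there is a left almost split morphism $M\to N$ in $\mathsf C$ with $\chi=\chi_M$. -/

import Mathlib

open CategoryTheory CategoryTheory.Limits

universe v u

namespace LengthCategory

section

variable {C : Type u} [Category.{v} C] [Abelian C]

/-- A character for `C`: a function on objects with values in `ℕ` that is additive on direct sums
and satisfies `χ Y ≤ χ X + χ Z` for each exact sequence `X ⟶ Y ⟶ Z ⟶ 0`. -/
structure IsCharacter (χ : C → ℕ) : Prop where
  biprod : ∀ X Y : C, χ (X ⊞ Y) = χ X + χ Y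
  rightExact : ∀ S : ShortComplex C, S.Exact → Epi S.g → χ S.X₂ ≤ χ S.X₁ + χ S.X₃

/-- A nonzero character that is not a sum of two nonzero characters. -/
structure IsIrreducibleCharacter (χ : C → ℕ) : Prop where
  isCharacter : IsCharacter χ
  ne_zero : χ ≠ 0
  eq_zero_or_eq_zero : ∀ χ₁ χ₂ : C → ℕ, IsCharacter χ₁ → IsCharacter χ₂ →
    χ = χ₁ + χ₂ → χ₁ = 0 ∨ χ₂ = 0

variable (C) in
/-- The set `Sp C` of irreducible characters for `C`. It is a structure rather than a subtype of
`C → ℕ`, so that it does not carry the product topology. -/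
@[ext]
structure Sp where
  toFun : C → ℕ
  isIrreducible : IsIrreducibleCharacter toFun

/-- The value `χ(α) = χ(X) - χ(Y) + χ(Coker α)` at a morphism `α : X ⟶ Y`, as an integer. -/
noncomputable def morphismValue (χ : C → ℕ) {X Y : C} (α : X ⟶ Y) : ℤ :=
  (χ X : ℤ) - (χ Y : ℤ) + (χ (cokernel α) : ℤ)

/-- The set `U_α` of irreducible characters that do not vanish at `α`. -/
def basicOpen {X Y : C} (α : X ⟶ Y) : Set (Sp C) :=
  {χ | morphismValue χ.toFun α ≠ 0}

/-- The topology on `Sp C` generated by the sets `U_α`, for all morphisms `α` in `C`. -/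
instance : TopologicalSpace (Sp C) :=
  TopologicalSpace.generateFrom {U | ∃ (X Y : C) (α : X ⟶ Y), U = basicOpen α}

/-- The character `χ_M` of an object `M`: its value at `X` is the length of `Hom(X, M)` as a module
over `End(M)`, acting by composition. -/
noncomputable def objectCharacter (M : C) (X : C) : ℕ∞ :=
  Module.length (End M) (X ⟶ M)

/-- `φ : M ⟶ N` is left almost split if it is not a split monomorphism and every morphism
`M ⟶ N'` that is not a split monomorphism factors through `φ`. -/
def IsLeftAlmostSplit {M N : C} (φ : M ⟶ N) : Prop :=
  ¬ IsSplitMono φ ∧ ∀ (N' : C) (f : M ⟶ N'), ¬ IsSplitMono f → ∃ g : N ⟶ N', φ ≫ g = f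

end

end LengthCategory

/-! A morphism `α : X ⟶ Y` presents the functor F_α = Coker(Hom(Y,-) → Hom(X,-)), and a character is
an additive non-negative function on such functors, with `morphismValue χ α` its value at F_α.
`Factors β α` means im β ⊆ im α inside Hom(X,-). For χ_M the value at `α` is the `End M`-length of
F_α(M).

If `φ : M ⟶ N` is left almost split, then F_φ is simple and concentrated at M. Peeling copies of it
off F_α (`devissage`) shows that an irreducible ψ with ψ(φ) ≠ 0 dominates χ_M at all morphisms. Then
ψ - χ_M is a character, so ψ = χ_M and U_φ = {χ_M}.

Conversely, let {χ} be open. If an irreducible χ is non-zero on two functors, it is non-zero on a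
subquotient of one whose support lies in both supports (`IsIrreducibleCharacter.exists_link`). Hence
a finite intersection of sets U_α around χ shrinks to one `γ` with χ(γ) ≠ 0 such that χ_M = χ for
every local M with F_γ(M) ≠ 0. Local objects are determined by their characters, so only one local M
occurs up to isomorphism. A non-zero element of F_γ(M) generates a subfunctor presented by a
morphism out of M; adjoining generators of the radical of `End M` makes it left almost split. -/

open scoped ZeroObject

set_option linter.unusedSectionVars false

namespace LengthCategory

/-! ### Characters as additive functions on finitely presented functors. -/

section Factorization

variable {C : Type u} [Category.{v} C] [Abelian C]

/-- `f` factors through `α`, for two morphisms with the same source. -/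
def Factors {X Y Z : C} (f : X ⟶ Z) (α : X ⟶ Y) : Prop := ∃ g : Y ⟶ Z, α ≫ g = f

lemma Factors.refl {X Y : C} (α : X ⟶ Y) : Factors α α := ⟨𝟙 _, by simp⟩

lemma Factors.trans {X Y Z W : C} {f : X ⟶ Z} {g : X ⟶ Y} {h : X ⟶ W} (hfg : Factors f g)
    (hgh : Factors g h) : Factors f h := by
  obtain ⟨a, rfl⟩ := hfg
  obtain ⟨b, rfl⟩ := hgh
  exact ⟨b ≫ a, by simp⟩

lemma Factors.comp {X Y Z W : C} {f : X ⟶ Z} {α : X ⟶ Y} (h : Factors f α) (g : Z ⟶ W) :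
    Factors (f ≫ g) α := by
  obtain ⟨a, rfl⟩ := h
  exact ⟨a ≫ g, by simp⟩

lemma Factors.precomp {X Y Z W : C} {f : X ⟶ Z} {α : X ⟶ Y} (h : Factors f α) (g : W ⟶ X) :
    Factors (g ≫ f) (g ≫ α) := by
  obtain ⟨a, rfl⟩ := h
  exact ⟨a, by simp⟩

lemma Factors.of_id {X Z : C} (f : X ⟶ Z) : Factors f (𝟙 X) := ⟨f, by simp⟩

lemma Factors.add {X Y Z : C} {f g : X ⟶ Z} {α : X ⟶ Y} (hf : Factors f α) (hg : Factors g α) :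
    Factors (f + g) α := by
  obtain ⟨a, rfl⟩ := hf
  obtain ⟨b, rfl⟩ := hg
  exact ⟨a + b, by simp⟩

lemma Factors.zero {X Y Z : C} (α : X ⟶ Y) : Factors (0 : X ⟶ Z) α := ⟨0, by simp⟩

lemma Factors.lift {X Y Z W : C} {f : X ⟶ Z} {g : X ⟶ W} {α : X ⟶ Y} (hf : Factors f α)
    (hg : Factors g α) : Factors (biprod.lift f g) α := by
  obtain ⟨a, rfl⟩ := hf
  obtain ⟨b, rfl⟩ := hg
  exact ⟨biprod.lift a b, by ext <;> simp⟩

lemma factors_lift_left {X Y Z : C} (α : X ⟶ Y) (f : X ⟶ Z) : Factors α (biprod.lift α f) :=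
  ⟨biprod.fst, by simp⟩

lemma factors_lift_right {X Y Z : C} (α : X ⟶ Y) (f : X ⟶ Z) : Factors f (biprod.lift α f) :=
  ⟨biprod.snd, by simp⟩

lemma factors_lift_iff {X Y Z W : C} (α : X ⟶ Y) (f : X ⟶ Z) (g : X ⟶ W) :
    Factors g (biprod.lift α f) ↔ ∃ (a : Y ⟶ W) (b : Z ⟶ W), α ≫ a + f ≫ b = g := by
  constructor
  · rintro ⟨c, rfl⟩
    exact ⟨biprod.inl ≫ c, biprod.inr ≫ c, by
      rw [← Category.assoc, ← Category.assoc, ← Preadditive.add_comp]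
      congr 1
      ext <;> simp⟩
  · rintro ⟨a, b, rfl⟩
    exact ⟨biprod.desc a b, by simp⟩

lemma isSplitMono_iff_factors {X Y : C} (α : X ⟶ Y) : IsSplitMono α ↔ Factors (𝟙 X) α :=
  ⟨fun _ ↦ ⟨retraction α, by simp⟩, fun ⟨g, hg⟩ ↦ IsSplitMono.mk' ⟨g, hg⟩⟩

/-- The pushout of `α` along `f`, as a morphism out of the target of `f`. -/
noncomputable def relPushout {X Y M : C} (α : X ⟶ Y) (f : X ⟶ M) :
    M ⟶ cokernel (biprod.lift α f) :=
  biprod.inr ≫ cokernel.π (biprod.lift α f)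

lemma lift_comp {X Y M Z : C} (α : X ⟶ Y) (f : X ⟶ M) (c : Y ⊞ M ⟶ Z) :
    biprod.lift α f ≫ c = α ≫ biprod.inl ≫ c + f ≫ biprod.inr ≫ c := by
  rw [biprod.lift_eq, Preadditive.add_comp, Category.assoc, Category.assoc]

lemma relPushout_condition {X Y M : C} (α : X ⟶ Y) (f : X ⟶ M) :
    α ≫ biprod.inl ≫ cokernel.π (biprod.lift α f) + f ≫ relPushout α f = 0 := by
  rw [relPushout, ← lift_comp, cokernel.condition]

/-- Hence `relPushout α f` presents the subfunctor of F_α generated by the class of `f`. -/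
lemma factors_relPushout_iff {X Y M Z : C} (α : X ⟶ Y) (f : X ⟶ M) (g : M ⟶ Z) :
    Factors g (relPushout α f) ↔ Factors (f ≫ g) α := by
  constructor
  · rintro ⟨h, rfl⟩
    refine ⟨-(biprod.inl ≫ cokernel.π (biprod.lift α f) ≫ h), ?_⟩
    have := relPushout_condition α f =≫ h
    simp only [Preadditive.add_comp, Category.assoc, zero_comp] at this
    rw [Preadditive.comp_neg, neg_eq_iff_add_eq_zero, this]
  · rintro ⟨h, hh⟩
    refine ⟨cokernel.desc _ (biprod.desc (-h) g) ?_, ?_⟩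
    · simp [hh]
    · simp [relPushout]

/-- The cokernel of a pushout is the original cokernel. -/
noncomputable def cokernelRelPushoutIso {X Y M : C} (α : X ⟶ Y) (f : X ⟶ M) :
    cokernel (relPushout α f) ≅ cokernel α where
  hom := cokernel.desc _ (cokernel.desc _ (biprod.fst ≫ cokernel.π α) (by simp))
    (by simp [relPushout])
  inv := cokernel.desc _ (biprod.inl ≫ cokernel.π _ ≫ cokernel.π _) (by
    have := relPushout_condition α f =≫ cokernel.π (relPushout α f)
    simpa only [Preadditive.add_comp, Category.assoc, zero_comp, cokernel.condition, comp_zero,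
      add_zero] using this)
  hom_inv_id := by
    ext
    · simp
    · have h2 := cokernel.condition (relPushout α f)
      simp only [relPushout, Category.assoc] at h2
      simp only [coequalizer_as_cokernel, cokernel.π_desc_assoc, Category.assoc, biprod.inr_fst_assoc,
        zero_comp, Category.comp_id]
      exact h2.symm
  inv_hom_id := by
    ext
    simp

namespace IsCharacter

variable {χ : C → ℕ}

lemma map_zero (h : IsCharacter χ) : χ (0 : C) = 0 := by
  -- Isomorphism invariance is not yet available, and two copies of 0 give only a trivial
  -- inequality; four copies give 4χ(0) ≤ 2χ(0).
  have h1 := h.biprod (0 : C) 0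
  have h2 := h.biprod ((0 : C) ⊞ 0) (0 ⊞ 0)
  have hz : IsZero ((0 : C) ⊞ 0) := by
    rw [IsZero.iff_id_eq_zero]; ext
  have hz2 : IsZero (((0 : C) ⊞ 0) ⊞ (0 ⊞ 0)) := by
    rw [IsZero.iff_id_eq_zero]; ext
  have := h.rightExact (ShortComplex.mk (0 : (0 : C) ⟶ ((0 : C) ⊞ 0) ⊞ (0 ⊞ 0))
    (0 : _ ⟶ (0 : C)) (by simp)) (ShortComplex.exact_of_isZero_X₂ _ hz2)
    ((IsZero.epi (isZero_zero C)) _)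
  simp only at this
  omega

lemma le_of_iso (h : IsCharacter χ) {X Y : C} (e : X ≅ Y) : χ X ≤ χ Y := by
  have := h.rightExact (ShortComplex.mk (0 : (0 : C) ⟶ X) e.hom (by simp))
    ((ShortComplex.exact_iff_mono _ rfl).2 (by dsimp; infer_instance)) (by dsimp; infer_instance)
  simpa [h.map_zero] using this

lemma map_iso (h : IsCharacter χ) {X Y : C} (e : X ≅ Y) : χ X = χ Y :=
  le_antisymm (h.le_of_iso e) (h.le_of_iso e.symm)

lemma value_nonneg (h : IsCharacter χ) {X Y : C} (α : X ⟶ Y) : 0 ≤ morphismValue χ α := by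
  have := h.rightExact (ShortComplex.mk α (cokernel.π α) (by simp))
    (ShortComplex.exact_cokernel α) (by dsimp; infer_instance)
  simp only at this
  unfold morphismValue
  omega

/-- Additivity on the exact sequence formed by the subfunctor of F_α generated by `f`, F_α itself,
and the quotient, which `biprod.lift α f` presents. -/
lemma value_eq_add (h : IsCharacter χ) {X Y M : C} (α : X ⟶ Y) (f : X ⟶ M) :
    morphismValue χ α = morphismValue χ (relPushout α f) + morphismValue χ (biprod.lift α f) := by
  unfold morphismValue
  rw [h.map_iso (cokernelRelPushoutIso α f), h.biprod]
  push_cast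
  ring

lemma value_comp_iso (h : IsCharacter χ) {X Y Y' : C} (α : X ⟶ Y) (e : Y ≅ Y') :
    morphismValue χ (α ≫ e.hom) = morphismValue χ α := by
  unfold morphismValue
  rw [h.map_iso e, h.map_iso (cokernelCompIsIso α e.hom)]

lemma value_eq_zero_of_isSplitMono (h : IsCharacter χ) {X Y : C} (α : X ⟶ Y)
    (hα : Factors (𝟙 X) α) : morphismValue χ α = 0 := by
  obtain ⟨r, hr⟩ := hα
  have : Mono α := (SplitMono.mk r hr).mono
  let S := ShortComplex.mk α (cokernel.π α) (by simp)
  have hS : S.ShortExact := { exact := ShortComplex.exact_cokernel α }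
  have e := (ShortComplex.Splitting.ofExactOfRetraction S hS.exact r hr
    hS.epi_g).isoBinaryBiproduct
  have := h.map_iso e
  rw [h.biprod] at this
  simp only [S] at this
  unfold morphismValue
  omega

/-- F_α is a quotient of F_β, since im β ⊆ im α. -/
lemma value_antitone (h : IsCharacter χ) {X Y Z : C} {α : X ⟶ Y} {β : X ⟶ Z} (hβ : Factors β α) :
    morphismValue χ α ≤ morphismValue χ β := by
  have h1 := h.value_eq_add α β
  rw [h.value_eq_zero_of_isSplitMono (relPushout α β)
    ((factors_relPushout_iff _ _ _).2 (by simpa using hβ))] at h1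
  have h2 := h.value_eq_add β α
  have h3 := h.value_nonneg (relPushout β α)
  have h4 : morphismValue χ (biprod.lift α β) = morphismValue χ (biprod.lift β α) := by
    rw [← h.value_comp_iso (biprod.lift α β) (biprod.braiding _ _)]
    congr 1
    ext <;> simp
  omega

lemma value_congr (h : IsCharacter χ) {X Y Z : C} {α : X ⟶ Y} {β : X ⟶ Z} (h₁ : Factors β α)
    (h₂ : Factors α β) : morphismValue χ α = morphismValue χ β :=
  le_antisymm (h.value_antitone h₁) (h.value_antitone h₂)

lemma value_id (h : IsCharacter χ) (X : C) : morphismValue χ (𝟙 X) = 0 :=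
  h.value_eq_zero_of_isSplitMono _ (Factors.refl _)

lemma value_zero (h : IsCharacter χ) (X Y : C) :
    morphismValue χ (0 : X ⟶ Y) = χ X := by
  unfold morphismValue
  rw [h.map_iso cokernelZeroIsoTarget]
  ring

/-- The value at the pushout given by an interval: `β` factors through `α`. -/
lemma value_relPushout (h : IsCharacter χ) {X Y Z : C} {α : X ⟶ Y} {β : X ⟶ Z}
    (hβ : Factors β α) :
    morphismValue χ (relPushout β α) = morphismValue χ β - morphismValue χ α := by
  rw [h.value_eq_add β α, h.value_congr (α := biprod.lift β α) (β := α)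
    (factors_lift_right _ _) (hβ.lift (Factors.refl _))]
  ring

lemma of_value_nonneg (hb : ∀ X Y : C, χ (X ⊞ Y) = χ X + χ Y)
    (hiso : ∀ {X Y : C}, (X ≅ Y) → χ X = χ Y)
    (hv : ∀ {X Y : C} (α : X ⟶ Y), 0 ≤ morphismValue χ α) : IsCharacter χ where
  biprod := hb
  rightExact S hS hg := by
    have e : cokernel S.f ≅ S.X₃ :=
      (cokernelIsCokernel S.f).coconePointUniqueUpToIso hS.gIsCokernel
    have := hv S.f
    unfold morphismValue at this
    rw [hiso e] at this
    omega

end IsCharacter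

end Factorization

/-! ### The characters of objects. -/

section ObjectCharacter

variable {C : Type u} [Category.{v} C] [Abelian C]

/-- Precomposition with `α` as a map of `End M`-modules. -/
def precompHom (M : C) {X Y : C} (α : X ⟶ Y) : (Y ⟶ M) →ₗ[End M] (X ⟶ M) where
  toFun g := α ≫ g
  map_add' := by simp
  map_smul' r g := (Category.assoc α g r).symm

@[simp]
lemma precompHom_apply (M : C) {X Y : C} (α : X ⟶ Y) (g : Y ⟶ M) :
    precompHom M α g = α ≫ g := rfl

lemma mem_range_precompHom {M X Y : C} (α : X ⟶ Y) (f : X ⟶ M) :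
    f ∈ LinearMap.range (precompHom M α) ↔ Factors f α := Iff.rfl

lemma objectCharacter_eq_add (M : C) {X Y : C} (α : X ⟶ Y) :
    objectCharacter M Y =
      objectCharacter M (cokernel α) + Module.length (End M) (LinearMap.range (precompHom M α)) := by
  refine Module.length_eq_add_of_exact (precompHom M (cokernel.π α))
    (precompHom M α).rangeRestrict ?_ (precompHom M α).surjective_rangeRestrict ?_
  · intro f g hfg
    exact (cancel_epi (cokernel.π α)).1 hfg
  · intro g
    rw [Subtype.ext_iff]
    exact ⟨fun hg ↦ ⟨cokernel.desc α g hg, cokernel.π_desc _ _ _⟩, by rintro ⟨h, rfl⟩; simp⟩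

lemma objectCharacter_biprod (M X Y : C) :
    objectCharacter M (X ⊞ Y) = objectCharacter M X + objectCharacter M Y := by
  let e : (X ⊞ Y ⟶ M) ≃ₗ[End M] (X ⟶ M) × (Y ⟶ M) :=
    { (precompHom M (biprod.inl : X ⟶ X ⊞ Y)).prod (precompHom M (biprod.inr : Y ⟶ X ⊞ Y)) with
      invFun p := biprod.desc p.1 p.2
      left_inv f := by apply biprod.hom_ext' <;> simp
      right_inv p := by ext <;> simp }
  rw [objectCharacter, e.length_eq, Module.length_prod]
  rfl

lemma objectCharacter_iso (M : C) {X Y : C} (e : X ≅ Y) :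
    objectCharacter M X = objectCharacter M Y := by
  let e : (X ⟶ M) ≃ₗ[End M] (Y ⟶ M) :=
    { precompHom M e.inv with
      invFun f := e.hom ≫ f
      left_inv f := by simp
      right_inv p := by simp }
  exact e.length_eq

/-- The character of `M` with natural number values. -/
noncomputable def natCharacter (M X : C) : ℕ := (objectCharacter M X).toNat

lemma coe_natCharacter (hfin : ∀ M X : C, objectCharacter M X ≠ ⊤) (M X : C) :
    (natCharacter M X : ℕ∞) = objectCharacter M X := ENat.natCast_toNat (hfin M X)

/-- The quotient is F_α(M); its length comes from the exact sequence 0 → Hom(Coker α, M) → Hom(Y, M)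
→ Hom(X, M) → F_α(M) → 0. -/
lemma morphismValue_natCharacter (hfin : ∀ M X : C, objectCharacter M X ≠ ⊤) (M : C) {X Y : C}
    (α : X ⟶ Y) : ∃ n : ℕ, morphismValue (natCharacter M) α = n ∧
      Module.length (End M) ((X ⟶ M) ⧸ LinearMap.range (precompHom M α)) = n := by
  have h1 := objectCharacter_eq_add M α
  have h2 := Module.length_eq_add_of_exact (LinearMap.range (precompHom M α)).subtype
    (LinearMap.range (precompHom M α)).mkQ (Submodule.injective_subtype _)
    (Submodule.mkQ_surjective _) (LinearMap.exact_subtype_mkQ _)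
  change objectCharacter M X = _ at h2
  have hX := coe_natCharacter hfin M X
  have hY := coe_natCharacter hfin M Y
  have hZ := coe_natCharacter hfin M (cokernel α)
  rw [← hX] at h2
  rw [← hY, ← hZ] at h1
  obtain ⟨a, ha⟩ := ENat.ne_top_iff_exists.1 (show
    Module.length (End M) (LinearMap.range (precompHom M α)) ≠ ⊤ by
      intro h; rw [h] at h2; simp at h2)
  obtain ⟨b, hb⟩ := ENat.ne_top_iff_exists.1 (show
    Module.length (End M) ((X ⟶ M) ⧸ LinearMap.range (precompHom M α)) ≠ ⊤ by
      intro h; rw [h] at h2; simp at h2)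
  rw [← ha] at h1
  rw [← ha, ← hb] at h2
  norm_cast at h1 h2
  refine ⟨b, ?_, hb.symm⟩
  unfold morphismValue
  omega

lemma isCharacter_natCharacter (hfin : ∀ M X : C, objectCharacter M X ≠ ⊤) (M : C) :
    IsCharacter (natCharacter M) :=
  .of_value_nonneg
    (fun X Y ↦ by
      have := objectCharacter_biprod M X Y
      simp only [← coe_natCharacter hfin] at this
      exact_mod_cast this)
    (fun e ↦ by rw [natCharacter, objectCharacter_iso M e, natCharacter])
    (fun α ↦ by
      obtain ⟨n, hn, -⟩ := morphismValue_natCharacter hfin M α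
      rw [hn]
      exact Int.natCast_nonneg n)

lemma morphismValue_natCharacter_ne_zero_iff (hfin : ∀ M X : C, objectCharacter M X ≠ ⊤) (M : C)
    {X Y : C} (α : X ⟶ Y) :
    morphismValue (natCharacter M) α ≠ 0 ↔ ∃ f : X ⟶ M, ¬ Factors f α := by
  obtain ⟨n, hn, hl⟩ := morphismValue_natCharacter hfin M α
  have : morphismValue (natCharacter M) α = 0 ↔
      Module.length (End M) ((X ⟶ M) ⧸ LinearMap.range (precompHom M α)) = 0 := by
    rw [hn, hl]; norm_cast
  rw [Ne, this, Module.length_eq_zero_iff, Submodule.Quotient.subsingleton_iff,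
    Submodule.eq_top_iff']
  push Not
  rfl

/-- An endomorphism outside the range of `φ` generates all of `End M`, so F_φ(M) is a simple module.
-/
lemma morphismValue_natCharacter_eq_one (hfin : ∀ M X : C, objectCharacter M X ≠ ⊤) {M N : C}
    (φ : M ⟶ N) (hM : ∃ f : M ⟶ M, ¬ Factors f φ)
    (hφ : ∀ f : M ⟶ M, ¬ Factors f φ → Factors (𝟙 M) f) :
    morphismValue (natCharacter M) φ = 1 := by
  obtain ⟨n, hn, hl⟩ := morphismValue_natCharacter hfin M φ
  have : IsSimpleModule (End M) ((M ⟶ M) ⧸ LinearMap.range (precompHom M φ)) := by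
    rw [isSimpleModule_iff_isCoatom]
    obtain ⟨f, hf⟩ := hM
    refine ⟨fun h ↦ hf ((mem_range_precompHom φ f).1 (h ▸ Submodule.mem_top)), fun S hS ↦ ?_⟩
    obtain ⟨g, hgS, hg⟩ := SetLike.exists_of_lt hS
    obtain ⟨r, hr⟩ := hφ g hg
    refine Submodule.eq_top_iff'.2 fun x ↦ ?_
    have := S.smul_mem (End.of (r ≫ x)) hgS
    change g ≫ r ≫ x ∈ S at this
    rwa [reassoc_of% hr] at this
  rw [Module.length_eq_one] at hl
  rw [hn]
  exact_mod_cast hl.symm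

variable {k : Type*} [CommRing k] [Linear k C]

lemma objectCharacter_ne_top (hhom : ∀ X Y : C, IsFiniteLength k (X ⟶ Y)) (M X : C) :
    objectCharacter M X ≠ ⊤ := by
  have : IsScalarTower k (End M) (X ⟶ M) := ⟨fun c r f ↦ Linear.comp_smul _ _ _ f c r⟩
  obtain ⟨_, _⟩ := isFiniteLength_iff_isNoetherian_isArtinian.1 (hhom X M)
  have := isNoetherian_of_tower k (S := End M) (M := X ⟶ M) inferInstance
  have := isArtinian_of_tower k (S := End M) (M := X ⟶ M) inferInstance
  exact Module.length_ne_top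

end ObjectCharacter

/-! ### Fitting's lemma, local objects and decompositions into them. -/

/-- Fitting's lemma: a power of an element of a finite length algebra generates a left ideal that
is generated by an idempotent. -/
lemma exists_isIdempotentElem_mul_pow (k : Type*) {R : Type*} [CommRing k] [Ring R] [Algebra k R]
    [IsNoetherian k R] [IsArtinian k R] (a : R) :
    ∃ (n : ℕ) (w : R), IsIdempotentElem (w * a ^ (n + 1)) ∧
      (1 - w * a ^ (n + 1)) * a ^ (n + 1) = 0 := by
  obtain ⟨n, hn⟩ := Filter.eventually_atTop.1
    (LinearMap.eventually_isCompl_ker_pow_range_pow (LinearMap.mulRight k a))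
  -- A positive exponent ensures that `w * a ^ (n + 1) = 1` makes `a` left invertible.
  have h := hn (n + 1) (Nat.le_succ n)
  rw [LinearMap.pow_mulRight] at h
  obtain ⟨x, hx, y, ⟨w, rfl⟩, hxy⟩ := Submodule.mem_sup.1
    (h.sup_eq_top ▸ Submodule.mem_top : (1 : R) ∈ _)
  simp only [LinearMap.mem_ker, LinearMap.mulRight_apply] at hx hxy
  have hu : x = 1 - w * a ^ (n + 1) := eq_sub_of_add_eq hxy
  refine ⟨n, w, ?_, hu ▸ hx⟩
  -- With e = w * a ^ (n + 1) and x = 1 - e, the element e * x lies in both kernel and range, so it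
  -- is zero.
  have h0 := Submodule.disjoint_def.1 h.disjoint (w * a ^ (n + 1) * x)
    (by simp [mul_assoc, hx])
    ⟨w - w * a ^ (n + 1) * w, by simp [hu, sub_mul, mul_sub, mul_assoc]⟩
  rw [hu, mul_sub, mul_one, sub_eq_zero] at h0
  exact h0.symm

section LocalObject

variable {C : Type u} [Category.{v} C] [Abelian C]

/-- A nonzero object such that for each sum of two endomorphisms equal to the identity one of them
is a split monomorphism. -/
structure IsLocalObject (M : C) : Prop where
  id_ne_zero : 𝟙 M ≠ 0
  splits : ∀ a b : M ⟶ M, a + b = 𝟙 M → Factors (𝟙 M) a ∨ Factors (𝟙 M) b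

namespace IsLocalObject

variable {M : C}

lemma factors_of_comp_add_comp (hM : IsLocalObject M) {Y Z : C} {f : M ⟶ Y} {g : M ⟶ Z}
    (a : Y ⟶ M) (b : Z ⟶ M) (h : f ≫ a + g ≫ b = 𝟙 M) :
    Factors (𝟙 M) f ∨ Factors (𝟙 M) g :=
  (hM.splits _ _ h).imp (fun h ↦ h.trans ⟨a, rfl⟩) (fun h ↦ h.trans ⟨b, rfl⟩)

lemma factors_of_add (hM : IsLocalObject M) {Z : C} {f g : M ⟶ Z} (h : Factors (𝟙 M) (f + g)) :
    Factors (𝟙 M) f ∨ Factors (𝟙 M) g := by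
  obtain ⟨c, hc⟩ := h
  exact hM.factors_of_comp_add_comp c c (by rw [← hc, Preadditive.add_comp])

lemma factors_of_lift (hM : IsLocalObject M) {Y Z : C} {f : M ⟶ Y} {g : M ⟶ Z}
    (h : Factors (𝟙 M) (biprod.lift f g)) : Factors (𝟙 M) f ∨ Factors (𝟙 M) g := by
  obtain ⟨a, b, hab⟩ := (factors_lift_iff _ _ _).1 h
  exact hM.factors_of_comp_add_comp a b hab

lemma not_factors_zero (hM : IsLocalObject M) (Z : C) : ¬ Factors (𝟙 M) (0 : M ⟶ Z) := by
  rintro ⟨g, hg⟩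
  exact hM.id_ne_zero (by rw [← hg, zero_comp])

lemma factors_one_sub (hM : IsLocalObject M) {N : C} {φ : M ⟶ N} (hφ : ¬ Factors (𝟙 M) φ)
    (b : N ⟶ M) : Factors (𝟙 M) (𝟙 M - φ ≫ b) :=
  (hM.splits (φ ≫ b) (𝟙 M - φ ≫ b) (by abel)).resolve_left fun h ↦ hφ (h.trans ⟨b, rfl⟩)

/-- A split monomorphism between local objects is invertible. -/
lemma nonempty_iso (hM : IsLocalObject M) {M' : C} (hM' : IsLocalObject M') {f : M ⟶ M'}
    (hf : Factors (𝟙 M) f) : Nonempty (M ≅ M') := by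
  obtain ⟨r, hr⟩ := hf
  rcases hM'.splits (r ≫ f) (𝟙 M' - r ≫ f) (by abel) with ⟨c, hc⟩ | ⟨c, hc⟩
  · refine ⟨⟨f, r, hr, ?_⟩⟩
    calc r ≫ f = (r ≫ f) ≫ (r ≫ f) ≫ c := by rw [hc, Category.comp_id]
      _ = (r ≫ f) ≫ c := by simp [reassoc_of% hr]
      _ = 𝟙 M' := hc
  · have h0 : r ≫ f = 0 := by
      calc r ≫ f = (r ≫ f) ≫ (𝟙 M' - r ≫ f) ≫ c := by rw [hc, Category.comp_id]
        _ = 0 := by simp [Preadditive.sub_comp, reassoc_of% hr]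
    refine absurd ?_ hM.id_ne_zero
    calc 𝟙 M = f ≫ (r ≫ f) ≫ r := by simp [hr]
      _ = 0 := by simp [h0]

variable {k : Type*} [CommRing k] [Linear k C]

variable (k) in
/-- The submodule of the morphisms that are not split monomorphisms. -/
def radical (hM : IsLocalObject M) (Z : C) : Submodule k (M ⟶ Z) where
  carrier := {f | ¬ Factors (𝟙 M) f}
  add_mem' hf hg h := (hM.factors_of_add h).elim hf hg
  zero_mem' := hM.not_factors_zero Z
  smul_mem' c f hf h := hf (h.trans ⟨c • 𝟙 Z, by simp⟩)

lemma exists_radical_approximation (hhom : ∀ X Y : C, IsFiniteLength k (X ⟶ Y))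
    (hM : IsLocalObject M) {P : C} {β : M ⟶ P} (hβ : ¬ Factors (𝟙 M) β) (Z : C) :
    ∃ (N : C) (φ : M ⟶ N), ¬ Factors (𝟙 M) φ ∧ Factors β φ ∧
      ∀ g : M ⟶ Z, ¬ Factors (𝟙 M) g → Factors g φ := by
  classical
  obtain ⟨_, _⟩ := isFiniteLength_iff_isNoetherian_isArtinian.1 (hhom M Z)
  obtain ⟨s, hs⟩ := IsNoetherian.noetherian (hM.radical k Z)
  -- Generators of the radical are adjoined to `β` one at a time; locality of M keeps the result
  -- non-split.
  have key : ∀ t : Finset (M ⟶ Z), (∀ g ∈ t, ¬ Factors (𝟙 M) g) → ∃ (N : C) (φ : M ⟶ N),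
      ¬ Factors (𝟙 M) φ ∧ Factors β φ ∧ ∀ g ∈ t, Factors g φ := by
    intro t
    induction t using Finset.induction_on with
    | empty => exact fun _ ↦ ⟨P, β, hβ, Factors.refl _, by simp⟩
    | insert a t _ ih =>
      intro ht
      obtain ⟨N, φ, h1, h2, h3⟩ := ih fun g hg ↦ ht g (Finset.mem_insert_of_mem hg)
      refine ⟨N ⊞ Z, biprod.lift φ a, fun h ↦ ?_, h2.trans (factors_lift_left _ _), ?_⟩
      · exact (hM.factors_of_lift h).elim h1 (ht a (Finset.mem_insert_self _ _))
      · intro g hg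
        rcases Finset.mem_insert.1 hg with rfl | hg
        · exact factors_lift_right _ _
        · exact (h3 g hg).trans (factors_lift_left _ _)
  obtain ⟨N, φ, h1, h2, h3⟩ := key s fun g hg ↦
    show g ∈ hM.radical k Z from hs ▸ Submodule.subset_span hg
  refine ⟨N, φ, h1, h2, fun g hg ↦ ?_⟩
  have hg' : g ∈ hM.radical k Z := hg
  rw [← hs] at hg'
  induction hg' using Submodule.span_induction with
  | mem x hx => exact h3 x hx
  | zero => exact Factors.zero _
  | add x y hx hy ihx ihy =>
    rw [hs] at hx hy
    exact (ihx hx).add (ihy hy)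
  | smul c x hx ih =>
    rw [hs] at hx
    obtain ⟨a, ha⟩ := ih hx
    exact ⟨c • a, by simp [ha]⟩

/-- Local objects are isomorphic when their characters have the same support. -/
lemma nonempty_iso_of_character (hhom : ∀ X Y : C, IsFiniteLength k (X ⟶ Y))
    (hM : IsLocalObject M) {M' : C} (hM' : IsLocalObject M')
    (h : natCharacter M = natCharacter M') : Nonempty (M ≅ M') := by
  by_contra hiso
  -- Without an isomorphism every morphism to `M'` is non-split, so F_φ vanishes at `M'` but not at
  -- M.
  obtain ⟨N, φ, h1, -, h2⟩ := hM.exists_radical_approximation hhom (hM.not_factors_zero M) M'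
  have h3 := (morphismValue_natCharacter_ne_zero_iff (objectCharacter_ne_top hhom) M φ).2 ⟨𝟙 M, h1⟩
  rw [h] at h3
  obtain ⟨f, hf⟩ :=
    (morphismValue_natCharacter_ne_zero_iff (objectCharacter_ne_top hhom) M' φ).1 h3
  exact hf (h2 f fun hf' ↦ hiso (hM.nonempty_iso hM' hf'))

end IsLocalObject

variable {k : Type*} [CommRing k] [Linear k C]

/-- `End Y` embeds in `End X` as a corner that misses the identity. This makes the splitting of
idempotents terminate. -/
lemma length_end_lt (hhom : ∀ X Y : C, IsFiniteLength k (X ⟶ Y)) {X Y : C} (i : Y ⟶ X) (p : X ⟶ Y)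
    (hip : i ≫ p = 𝟙 Y) (hpi : p ≫ i ≠ 𝟙 X) :
    Module.length k (Y ⟶ Y) < Module.length k (X ⟶ X) := by
  obtain ⟨_, _⟩ := isFiniteLength_iff_isNoetherian_isArtinian.1 (hhom X X)
  let F : (Y ⟶ Y) →ₗ[k] (X ⟶ X) := Linear.leftComp k X p ∘ₗ Linear.rightComp k Y i
  have hF (f : Y ⟶ Y) : F f = p ≫ f ≫ i := rfl
  have hinj : Function.Injective F := fun f g hfg ↦ by
    have := i ≫= hfg =≫ p
    simpa [hF, hip, reassoc_of% hip] using this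
  rw [(LinearEquiv.ofInjective F hinj).length_eq]
  refine Submodule.length_lt fun h ↦ hpi ?_
  obtain ⟨f, hf⟩ : 𝟙 X ∈ LinearMap.range F := h ▸ Submodule.mem_top
  rw [hF] at hf
  calc p ≫ i = p ≫ i ≫ p ≫ f ≫ i := by rw [hf, Category.comp_id]
    _ = 𝟙 X := by rw [reassoc_of% hip, hf]

/-- Let a + b = 1 with neither left invertible. If the Fitting idempotent of a is 0, then a is
nilpotent and b is a unit; if it is 1, then a is left invertible. -/
lemma exists_idempotent_of_not_isLocalObject (hhom : ∀ X Y : C, IsFiniteLength k (X ⟶ Y)) {X : C}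
    (h0 : 𝟙 X ≠ 0) (hX : ¬ IsLocalObject X) :
    ∃ e : X ⟶ X, e ≫ e = e ∧ e ≠ 0 ∧ e ≠ 𝟙 X := by
  obtain ⟨_, _⟩ := isFiniteLength_iff_isNoetherian_isArtinian.1 (hhom X X)
  have h1 : ∃ a b : End X, a + b = 1 ∧ (∀ c : End X, c * a ≠ 1) ∧ ∀ c : End X, c * b ≠ 1 := by
    by_contra! h
    refine hX ⟨h0, fun a b hab ↦ ?_⟩
    by_contra! h'
    obtain ⟨c, hc⟩ := h a b hab fun c hc ↦ h'.1 ⟨c, hc⟩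
    exact h'.2 ⟨c, hc⟩
  obtain ⟨a, b, hab, ha, hb⟩ := h1
  have : IsNoetherian k (End X) := ‹IsNoetherian k (X ⟶ X)›
  have : IsArtinian k (End X) := ‹IsArtinian k (X ⟶ X)›
  obtain ⟨n, w, he, hn⟩ := exists_isIdempotentElem_mul_pow k a
  refine ⟨w * a ^ (n + 1), he, fun h ↦ ?_, fun h ↦ ?_⟩
  · have h' : w * a ^ (n + 1) = 0 := h
    rw [h', sub_zero, one_mul] at hn
    obtain ⟨c, hc⟩ := (IsNilpotent.isUnit_one_sub ⟨n + 1, hn⟩ : IsUnit (1 - a)).exists_left_inv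
    exact hb c (by rwa [eq_sub_of_add_eq' hab])
  · exact ha (w * a ^ n) (by rw [mul_assoc, ← pow_succ]; exact h)

/-- An object with finite length endomorphism ring is built from local objects by direct sums. -/
lemma local_induction (hhom : ∀ X Y : C, IsFiniteLength k (X ⟶ Y)) {p : C → Prop}
    (hzero : ∀ X, 𝟙 X = 0 → p X) (hlocal : ∀ X, IsLocalObject X → p X)
    (hsum : ∀ X Y Z : C, (X ≅ Y ⊞ Z) → p Y → p Z → p X) (X : C) : p X := by
  have hwf : WellFounded fun X Y : C ↦ Module.length k (X ⟶ X) < Module.length k (Y ⟶ Y) :=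
    InvImage.wf _ wellFounded_lt
  induction X using hwf.induction with
  | _ X ih =>
    by_cases h0 : 𝟙 X = 0
    · exact hzero X h0
    by_cases hX : IsLocalObject X
    · exact hlocal X hX
    obtain ⟨e, he, he0, he1⟩ := exists_idempotent_of_not_isLocalObject hhom h0 hX
    obtain ⟨Y, i, q, hiq, hqi⟩ := IsIdempotentComplete.idempotents_split X e he
    obtain ⟨Z, j, r, hjr, hrj⟩ := IsIdempotentComplete.idempotents_split X (𝟙 X - e)
      (by simp [Preadditive.sub_comp, Preadditive.comp_sub, he])
    have hir : i ≫ r = 0 := by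
      calc i ≫ r = (i ≫ q) ≫ i ≫ r ≫ (j ≫ r) := by rw [hiq, hjr]; simp
        _ = i ≫ (q ≫ i) ≫ (r ≫ j) ≫ r := by simp
        _ = 0 := by rw [hqi, hrj]; simp [Preadditive.comp_sub, reassoc_of% he]
    have hjq : j ≫ q = 0 := by
      calc j ≫ q = (j ≫ r) ≫ j ≫ q ≫ (i ≫ q) := by rw [hiq, hjr]; simp
        _ = j ≫ (r ≫ j) ≫ (q ≫ i) ≫ q := by simp
        _ = 0 := by rw [hqi, hrj]; simp [Preadditive.sub_comp, reassoc_of% he]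
    refine hsum X Y Z ⟨biprod.lift q r, biprod.desc i j, ?_, ?_⟩ (ih Y ?_) (ih Z ?_)
    · rw [biprod.lift_desc, hqi, hrj]; abel
    · ext <;> simp [hiq, hjr, hir, hjq]
    · exact length_end_lt hhom i q hiq (hqi ▸ he1)
    · refine length_end_lt hhom j r hjr ?_
      rw [hrj]
      simpa using he0

/-- A character drops in three steps when a morphism into `M` that does not factor through `α` is
added to `α`. -/
lemma devissage {M N X Y : C} {φ : M ⟶ N} (hφ : ∀ b : N ⟶ M, Factors (𝟙 M) (𝟙 M - φ ≫ b))
    {α : X ⟶ Y} {f : X ⟶ M} (hf : ¬ Factors f α) :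
    ∃ (Y' P P' : C) (α' : X ⟶ Y') (β : M ⟶ P) (β' : N ⟶ P'), ¬ Factors (𝟙 M) β ∧ Factors φ β ∧
      ∀ ψ : C → ℕ, IsCharacter ψ →
        morphismValue ψ α = morphismValue ψ β' + morphismValue ψ β + morphismValue ψ α' := by
  refine ⟨_, _, _, biprod.lift (biprod.lift α (f ≫ φ)) f, relPushout (biprod.lift α (f ≫ φ)) f,
    relPushout α (f ≫ φ), fun h ↦ ?_, ?_, fun ψ hψ ↦ ?_⟩
  -- Nakayama: f = αa + fφb gives f(1 - φb) = αa, and 1 - φb has a right inverse in diagrammatic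
  -- order.
  · rw [factors_relPushout_iff, Category.comp_id, factors_lift_iff] at h
    obtain ⟨a, b, hab⟩ := h
    obtain ⟨c, hc⟩ := hφ b
    refine hf ⟨a ≫ c, ?_⟩
    calc α ≫ a ≫ c = (f - f ≫ φ ≫ b) ≫ c := by
          rw [← Category.assoc]; congr 1; rw [eq_sub_iff_add_eq, ← Category.assoc f φ b, hab]
      _ = f := by rw [← Category.comp_id f]; nth_rw 3 [← hc]; simp [Preadditive.sub_comp]
  · rw [factors_relPushout_iff]
    exact factors_lift_right _ _
  · rw [hψ.value_eq_add α (f ≫ φ), hψ.value_eq_add (biprod.lift α (f ≫ φ)) f, add_assoc]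

end LocalObject

/-! ### Intervals of subfunctors of Hom(X,-) and chains in them. -/

section Intervals

variable {C : Type u} [Category.{v} C] [Abelian C]

/-- The intersection of the subfunctors generated by `b` and `c`. -/
noncomputable def interPushout {X B D : C} (b : X ⟶ B) (c : X ⟶ D) :
    X ⟶ cokernel (biprod.lift b c) := c ≫ relPushout b c

lemma factors_interPushout_iff {X B D M : C} (b : X ⟶ B) (c : X ⟶ D) (g : X ⟶ M) :
    Factors g (interPushout b c) ↔ Factors g b ∧ Factors g c := by
  constructor
  · intro h
    exact ⟨h.trans ((factors_relPushout_iff _ _ _).1 (Factors.refl _)), h.trans ⟨_, rfl⟩⟩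
  · rintro ⟨h1, h, rfl⟩
    exact ((factors_relPushout_iff _ _ _).2 h1).precomp c

lemma IsCharacter.value_comp {χ : C → ℕ} (hχ : IsCharacter χ) {X Y Z : C} (α : X ⟶ Y)
    (b : Y ⟶ Z) :
    morphismValue χ (α ≫ b) = morphismValue χ (relPushout (α ≫ b) α) + morphismValue χ α := by
  have h : Factors (α ≫ b) α := ⟨b, rfl⟩
  rw [hχ.value_relPushout h]
  ring

/-- Second isomorphism theorem: im c / (im b ∩ im c) ≅ (im b + im c) / im b. -/
lemma IsCharacter.value_interPushout {χ : C → ℕ} (hχ : IsCharacter χ) {X B D : C} (b : X ⟶ B)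
    (c : X ⟶ D) : morphismValue χ (interPushout b c) =
      morphismValue χ b + morphismValue χ c - morphismValue χ (biprod.lift b c) := by
  have h : morphismValue χ (relPushout (c ≫ relPushout b c) c) =
      morphismValue χ (relPushout b c) := by
    apply hχ.value_congr
    · rw [factors_relPushout_iff]
      exact Factors.refl _
    · rw [factors_relPushout_iff]
      have : Factors (c ≫ relPushout (c ≫ relPushout b c) c) (interPushout b c) := by
        rw [interPushout, ← factors_relPushout_iff]
        exact Factors.refl _
      exact ((factors_interPushout_iff _ _ _).1 this).1
  rw [interPushout, hχ.value_comp, h, hχ.value_eq_add b c]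
  ring

/-- The subfunctors generated by `b` and `a` agree on the objects in `T`, if `b` factors
through `a`. -/
def AgreeOn (T : C → Prop) {X B A : C} (b : X ⟶ B) (a : X ⟶ A) : Prop :=
  ∀ M, T M → ∀ g : X ⟶ M, Factors g a → Factors g b

/-- The integers that are sums of the values of `χ` over some of the steps of a chain from
`b` to `a`, where only steps that are constant on `T` may be counted. -/
inductive ChainValue (χ : C → ℕ) (T : C → Prop) {X : C} :
    ∀ {B A : C}, (X ⟶ B) → (X ⟶ A) → ℤ → Prop
  | zero {B A : C} (b : X ⟶ B) (a : X ⟶ A) (h : Factors b a) : ChainValue χ T b a 0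
  | agree {B A : C} (b : X ⟶ B) (a : X ⟶ A) (h : Factors b a) (hT : AgreeOn T b a) :
      ChainValue χ T b a (morphismValue χ b - morphismValue χ a)
  | trans {B A D : C} (b : X ⟶ B) (a : X ⟶ A) (c : X ⟶ D) (m n : ℤ)
      (h₁ : ChainValue χ T b c m) (h₂ : ChainValue χ T c a n) : ChainValue χ T b a (m + n)

variable {χ : C → ℕ} {T : C → Prop}

namespace ChainValue

lemma factors {X B A : C} {b : X ⟶ B} {a : X ⟶ A} {n : ℤ} (h : ChainValue χ T b a n) :
    Factors b a := by
  induction h with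
  | zero b a h => exact h
  | agree b a h _ => exact h
  | trans b a c m n _ _ ih₁ ih₂ => exact ih₁.trans ih₂

lemma le (hχ : IsCharacter χ) {X B A : C} {b : X ⟶ B} {a : X ⟶ A} {n : ℤ}
    (h : ChainValue χ T b a n) : n ≤ morphismValue χ b - morphismValue χ a := by
  induction h with
  | zero b a h => have := hχ.value_antitone h; omega
  | agree b a h _ => exact le_rfl
  | trans b a c m n _ _ ih₁ ih₂ => omega

lemma congr {X B A B' A' : C} {b : X ⟶ B} {a : X ⟶ A} {b' : X ⟶ B'} {a' : X ⟶ A'} {n : ℤ}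
    (h : ChainValue χ T b a n) (hb : Factors b' b) (ha : Factors a a') :
    ChainValue χ T b' a' n := by
  have := ChainValue.trans _ _ _ _ _ (.zero _ _ hb) (.trans _ _ _ _ _ h (.zero _ _ ha))
  simpa using this

/-- The common refinement of a chain and a chain of length two. -/
lemma split (hχ : IsCharacter χ) {X B A D : C} {b : X ⟶ B} {a : X ⟶ A} {n : ℤ}
    (h : ChainValue χ T b a n) (c : X ⟶ D) :
    ∃ n₁ n₂, ChainValue χ T (interPushout b c) (interPushout a c) n₁ ∧
      ChainValue χ T (biprod.lift b c) (biprod.lift a c) n₂ ∧ n = n₁ + n₂ := by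
  have hinf : ∀ {B A : C} {b : X ⟶ B} {a : X ⟶ A}, Factors b a →
      Factors (interPushout b c) (interPushout a c) := fun {B A b a} h ↦ by
    have := (factors_interPushout_iff b c _).1 (Factors.refl _)
    exact (factors_interPushout_iff a c _).2 ⟨this.1.trans h, this.2⟩
  have hsup : ∀ {B A : C} {b : X ⟶ B} {a : X ⟶ A}, Factors b a →
      Factors (biprod.lift b c) (biprod.lift a c) := fun {B A b a} h ↦
    (h.trans (factors_lift_left _ _)).lift (factors_lift_right _ _)
  induction h with
  | zero b a h => exact ⟨0, 0, .zero _ _ (hinf h), .zero _ _ (hsup h), rfl⟩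
  | agree b a h hT =>
    -- Agreement on `T` survives intersection and sum with `c`, and the two values add up by
    -- inclusion-exclusion.
    refine ⟨_, _, .agree _ _ (hinf h) fun M hM g hg ↦ ?_,
      .agree _ _ (hsup h) fun M hM g hg ↦ ?_, ?_⟩
    · rw [factors_interPushout_iff] at hg ⊢
      exact ⟨hT M hM g hg.1, hg.2⟩
    · rw [factors_lift_iff] at hg
      obtain ⟨u, w, rfl⟩ := hg
      exact ((hT M hM _ ⟨u, rfl⟩).trans (factors_lift_left _ _)).add
        ((factors_lift_right b c).comp w)
    · rw [hχ.value_interPushout, hχ.value_interPushout]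
      ring
  | trans b a d m n _ _ ih₁ ih₂ =>
    obtain ⟨p₁, p₂, hp₁, hp₂, rfl⟩ := ih₁
    obtain ⟨q₁, q₂, hq₁, hq₂, rfl⟩ := ih₂
    exact ⟨_, _, .trans _ _ _ _ _ hp₁ hq₁, .trans _ _ _ _ _ hp₂ hq₂, by ring⟩

lemma exists_agreeOn {X B A : C} {b : X ⟶ B} {a : X ⟶ A} {n : ℤ}
    (h : ChainValue χ T b a n) (hn : 0 < n) :
    ∃ (B' A' : C) (b' : X ⟶ B') (a' : X ⟶ A'), Factors b b' ∧ Factors b' a' ∧ AgreeOn T b' a' ∧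
      0 < morphismValue χ b' - morphismValue χ a' := by
  induction h with
  | zero b a h => exact absurd hn (lt_irrefl _)
  | agree b a h hT => exact ⟨_, _, b, a, Factors.refl _, h, hT, hn⟩
  | trans b a c m n h₁ _ ih₁ ih₂ =>
    by_cases hm : 0 < m
    · exact ih₁ hm
    · obtain ⟨B', A', b', a', h⟩ := ih₂ (by omega)
      exact ⟨B', A', b', a', h₁.factors.trans h.1, h.2⟩

end ChainValue

/-- Hom(Coker α,-) is the kernel of Hom(Y,-) → Hom(X,-), so subfunctors of Hom(Y,-) containing it
correspond to subfunctors of im α. -/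
lemma factors_of_factors_comp {X Y B M : C} {α : X ⟶ Y} {b : Y ⟶ B}
    (hb : Factors (cokernel.π α) b) {g : Y ⟶ M} (hg : Factors (α ≫ g) (α ≫ b)) :
    Factors g b := by
  obtain ⟨w, hw⟩ := hg
  have h0 : α ≫ (g - b ≫ w) = 0 := by simp [Preadditive.comp_sub, ← hw]
  have h1 : Factors (g - b ≫ w) b := Factors.trans ⟨cokernel.desc α _ h0, by simp⟩ hb
  simpa using h1.add ⟨w, rfl⟩

lemma IsCharacter.value_comp_of_factors (hχ : IsCharacter χ) {X Y B : C} {α : X ⟶ Y} {b : Y ⟶ B}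
    (hb : Factors (cokernel.π α) b) :
    morphismValue χ (α ≫ b) = morphismValue χ b + morphismValue χ α := by
  rw [hχ.value_comp, hχ.value_congr (α := relPushout (α ≫ b) α) (β := b)]
  · rw [factors_relPushout_iff]
    exact Factors.refl _
  · exact factors_of_factors_comp hb ((factors_relPushout_iff _ _ _).1 (Factors.refl _))

namespace ChainValue

lemma comp (hχ : IsCharacter χ) {X Y B A : C} (α : X ⟶ Y) {b : Y ⟶ B} {a : Y ⟶ A} {n : ℤ}
    (h : ChainValue χ T b a n) (hb : Factors (cokernel.π α) b) :
    ChainValue χ T (α ≫ b) (α ≫ a) n := by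
  induction h with
  | zero b a h => exact .zero _ _ (h.precomp α)
  | agree b a h hT =>
    have : morphismValue χ b - morphismValue χ a =
        morphismValue χ (α ≫ b) - morphismValue χ (α ≫ a) := by
      rw [hχ.value_comp_of_factors hb, hχ.value_comp_of_factors (hb.trans h)]
      ring
    rw [this]
    refine .agree _ _ (h.precomp α) ?_
    rintro M hM _ ⟨u, rfl⟩
    rw [Category.assoc]
    exact (hT M hM _ ⟨u, rfl⟩).precomp α
  | trans b a c m n h₁ h₂ ih₁ ih₂ =>
    exact .trans _ _ _ _ _ (ih₁ hb) (ih₂ (hb.trans h₁.factors))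

/-- The endpoints are fixed only up to mutual factorization, because the intermediate terms of a
chain need not have the form `α ≫ c`. -/
lemma of_comp (hχ : IsCharacter χ) {X Y B A B' A' : C} {α : X ⟶ Y} {b' : X ⟶ B'} {a' : X ⟶ A'}
    {n : ℤ} (h : ChainValue χ T b' a' n) {b : Y ⟶ B} {a : Y ⟶ A}
    (hb : Factors (cokernel.π α) b) (ha : Factors (cokernel.π α) a)
    (hb₁ : Factors b' (α ≫ b)) (hb₂ : Factors (α ≫ b) b')
    (ha₁ : Factors a' (α ≫ a)) (ha₂ : Factors (α ≫ a) a') : ChainValue χ T b a n := by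
  induction h generalizing B A with
  | zero b' a' h =>
    exact .zero _ _ (factors_of_factors_comp ha (hb₂.trans (h.trans ha₁)))
  | agree b' a' h hT =>
    have : morphismValue χ b' - morphismValue χ a' = morphismValue χ b - morphismValue χ a := by
      rw [hχ.value_congr hb₂ hb₁, hχ.value_congr ha₂ ha₁, hχ.value_comp_of_factors hb,
        hχ.value_comp_of_factors ha]
      ring
    rw [this]
    refine .agree _ _ (factors_of_factors_comp ha (hb₂.trans (h.trans ha₁))) fun M hM g hg ↦ ?_
    exact factors_of_factors_comp hb
      ((hT M hM _ ((hg.precomp α).trans ha₂)).trans hb₁)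
  | trans b' a' c' m n h₁ h₂ ih₁ ih₂ =>
    -- The middle term is `α ≫ a ≫ u`; adjoining `cokernel.π α` to `a ≫ u` lifts it to a subfunctor
    -- containing the kernel.
    obtain ⟨u, hu⟩ := h₂.factors.trans ha₁
    have hc : Factors (cokernel.π α) (biprod.lift (a ≫ u) (cokernel.π α)) := factors_lift_right _ _
    have hc₁ : Factors c' (α ≫ biprod.lift (a ≫ u) (cokernel.π α)) := ⟨biprod.fst, by simp [← hu]⟩
    have hc₂ : Factors (α ≫ biprod.lift (a ≫ u) (cokernel.π α)) c' :=
      ⟨biprod.inl, by ext <;> simp [← hu]⟩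
    exact .trans _ _ _ _ _ (ih₁ hb hc hb₁ hb₂ hc₁ hc₂) (ih₂ hc ha hc₁ hc₂ ha₁ ha₂)

end ChainValue

/-! ### The mass of an interval and the splitting of a character along `T`. -/

variable (χ T) in
/-- The largest chain value of an interval. -/
noncomputable def mass {X B A : C} (b : X ⟶ B) (a : X ⟶ A) : ℤ :=
  sSup {n : ℤ | ChainValue χ T b a n}

lemma ChainValue.le_mass (hχ : IsCharacter χ) {X B A : C} {b : X ⟶ B} {a : X ⟶ A} {n : ℤ}
    (h : ChainValue χ T b a n) : n ≤ mass χ T b a :=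
  le_csSup ⟨_, fun _ hm ↦ ChainValue.le hχ hm⟩ h

lemma chainValue_mass (hχ : IsCharacter χ) {X B A : C} {b : X ⟶ B} {a : X ⟶ A}
    (h : Factors b a) : ChainValue χ T b a (mass χ T b a) :=
  Int.csSup_mem (s := {n : ℤ | ChainValue χ T b a n}) ⟨0, .zero _ _ h⟩
    ⟨_, fun _ hm ↦ ChainValue.le hχ hm⟩

lemma mass_nonneg (hχ : IsCharacter χ) {X B A : C} {b : X ⟶ B} {a : X ⟶ A}
    (h : Factors b a) : 0 ≤ mass χ T b a :=
  (ChainValue.zero _ _ h).le_mass hχ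

lemma mass_le (hχ : IsCharacter χ) {X B A : C} {b : X ⟶ B} {a : X ⟶ A}
    (h : Factors b a) : mass χ T b a ≤ morphismValue χ b - morphismValue χ a :=
  (chainValue_mass hχ h).le hχ

/-- Schreier refinement: a chain attaining the mass is intersected with `c` and summed with `c`. -/
lemma mass_add (hχ : IsCharacter χ) {X B A D : C} {b : X ⟶ B} {a : X ⟶ A} {c : X ⟶ D}
    (hbc : Factors b c) (hca : Factors c a) :
    mass χ T b a = mass χ T b c + mass χ T c a := by
  apply le_antisymm
  · obtain ⟨n₁, n₂, h₁, h₂, hn⟩ := (chainValue_mass (T := T) hχ (hbc.trans hca)).split hχ c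
    have h₁' := h₁.congr (b' := b) (a' := c)
      ((factors_interPushout_iff _ _ _).2 ⟨Factors.refl _, hbc⟩)
      ((factors_interPushout_iff _ _ _).1 (Factors.refl _)).2
    have h₂' := h₂.congr (b' := c) (a' := a) (factors_lift_right _ _) ((Factors.refl _).lift hca)
    rw [hn]
    exact add_le_add (h₁'.le_mass hχ) (h₂'.le_mass hχ)
  · exact (ChainValue.trans _ _ _ _ _ (chainValue_mass hχ hbc)
      (chainValue_mass hχ hca)).le_mass hχ

lemma mass_congr (hχ : IsCharacter χ) {X B A B' A' : C} {b : X ⟶ B} {a : X ⟶ A} {b' : X ⟶ B'}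
    {a' : X ⟶ A'} (hba : Factors b a) (hb₁ : Factors b' b) (hb₂ : Factors b b')
    (ha₁ : Factors a' a) (ha₂ : Factors a a') : mass χ T b a = mass χ T b' a' :=
  le_antisymm (((chainValue_mass hχ hba).congr hb₁ ha₂).le_mass hχ)
    (((chainValue_mass hχ (hb₁.trans (hba.trans ha₂))).congr hb₂ ha₁).le_mass hχ)

lemma mass_comp (hχ : IsCharacter χ) {X Y B A : C} (α : X ⟶ Y) {b : Y ⟶ B} {a : Y ⟶ A}
    (hba : Factors b a) (hb : Factors (cokernel.π α) b) :
    mass χ T (α ≫ b) (α ≫ a) = mass χ T b a :=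
  le_antisymm (((chainValue_mass hχ (hba.precomp α)).of_comp hχ hb (hb.trans hba)
      (Factors.refl _) (Factors.refl _) (Factors.refl _) (Factors.refl _)).le_mass hχ)
    (((chainValue_mass hχ hba).comp hχ α hb).le_mass hχ)

variable (χ T) in
/-- The part of the character `χ` that is concentrated on functors vanishing on `T`. -/
noncomputable def vanishingPart (X : C) : ℕ := (mass χ T (0 : X ⟶ (0 : C)) (𝟙 X)).toNat

lemma coe_vanishingPart (hχ : IsCharacter χ) (X : C) :
    (vanishingPart χ T X : ℤ) = mass χ T (0 : X ⟶ (0 : C)) (𝟙 X) :=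
  Int.toNat_of_nonneg (mass_nonneg hχ (Factors.of_id _))

lemma vanishingPart_le (hχ : IsCharacter χ) (X : C) : vanishingPart χ T X ≤ χ X := by
  have := mass_le (T := T) hχ (Factors.of_id (0 : X ⟶ (0 : C)))
  rw [← coe_vanishingPart hχ, hχ.value_zero, hχ.value_id] at this
  omega

lemma value_vanishingPart (hχ : IsCharacter χ) {X Y : C} (α : X ⟶ Y) :
    morphismValue (vanishingPart χ T) α = mass χ T α (𝟙 X) := by
  unfold morphismValue
  simp only [coe_vanishingPart hχ]
  have h1 := mass_add (T := T) hχ (Factors.zero (Z := (0 : C)) α) (Factors.of_id α)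
  have h2 := mass_add (T := T) hχ (Factors.zero (Z := (0 : C)) (cokernel.π α))
    (Factors.of_id (cokernel.π α))
  have h3 := mass_comp (T := T) hχ α (Factors.of_id (cokernel.π α)) (Factors.refl _)
  -- The interval from `cokernel.π α` to `𝟙 Y` is identified with the one from 0 to `α`.
  rw [mass_congr hχ ((Factors.of_id _).precomp α) (b' := (0 : X ⟶ (0 : C))) (a' := α)
    (Factors.zero _) (by rw [cokernel.condition]; exact Factors.zero _)
    (by rw [Category.comp_id]; exact Factors.refl _)
    (by rw [Category.comp_id]; exact Factors.refl _)] at h3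
  have h4 := mass_comp (T := T) hχ (cokernel.π α)
    (Factors.of_id (0 : cokernel α ⟶ (0 : C)))
    (by rw [cokernel.π_of_epi (cokernel.π α)]; exact Factors.zero _)
  rw [comp_zero, Category.comp_id] at h4
  omega

lemma value_vanishingPart_of_isSplitMono (hχ : IsCharacter χ) {X Y : C} {α : X ⟶ Y}
    (hα : Factors (𝟙 X) α) : morphismValue (vanishingPart χ T) α = 0 := by
  rw [value_vanishingPart hχ]
  have h1 := mass_le (T := T) hχ (Factors.of_id α)
  rw [hχ.value_eq_zero_of_isSplitMono _ hα, hχ.value_id] at h1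
  have h2 := mass_nonneg (T := T) hχ (Factors.of_id α)
  omega

lemma vanishingPart_iso (hχ : IsCharacter χ) {X Y : C} (e : X ≅ Y) :
    vanishingPart χ T X = vanishingPart χ T Y := by
  have h1 := value_vanishingPart_of_isSplitMono (T := T) hχ (α := e.hom) ⟨e.inv, by simp⟩
  have h2 := vanishingPart_le (T := T) hχ (cokernel e.hom)
  rw [hχ.map_iso (cokernel.ofEpi e.hom), hχ.map_zero] at h2
  unfold morphismValue at h1
  omega

lemma vanishingPart_biprod (hχ : IsCharacter χ) (X Y : C) :
    vanishingPart χ T (X ⊞ Y) = vanishingPart χ T X + vanishingPart χ T Y := by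
  have h1 := value_vanishingPart_of_isSplitMono (T := T) hχ
    (α := (biprod.inl : X ⟶ X ⊞ Y)) ⟨biprod.fst, by simp⟩
  have e : cokernel (biprod.inl : X ⟶ X ⊞ Y) ≅ Y := cokernelBiprodInlIso
  rw [morphismValue, vanishingPart_iso hχ e] at h1
  omega

lemma isCharacter_vanishingPart (hχ : IsCharacter χ) : IsCharacter (vanishingPart χ T) :=
  .of_value_nonneg (vanishingPart_biprod hχ) (vanishingPart_iso hχ) fun α ↦ by
    rw [value_vanishingPart hχ]
    exact mass_nonneg hχ (Factors.of_id α)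

lemma isCharacter_sub_vanishingPart (hχ : IsCharacter χ) :
    IsCharacter fun X ↦ χ X - vanishingPart χ T X := by
  refine .of_value_nonneg (fun X Y ↦ ?_) (fun e ↦ ?_) fun {X Y} α ↦ ?_
  · have h1 := vanishingPart_le (T := T) hχ X
    have h2 := vanishingPart_le (T := T) hχ Y
    rw [hχ.biprod, vanishingPart_biprod hχ]
    omega
  · rw [hχ.map_iso e, vanishingPart_iso hχ e]
  · have h1 := vanishingPart_le (T := T) hχ X
    have h2 := vanishingPart_le (T := T) hχ Y
    have h3 := vanishingPart_le (T := T) hχ (cokernel α)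
    have h4 := mass_le (T := T) hχ (Factors.of_id α)
    rw [← value_vanishingPart hχ, hχ.value_id] at h4
    simp only [morphismValue] at h4 ⊢
    omega

/-- Any two morphisms at which an irreducible character does not vanish have a common
subquotient at which it does not vanish. -/
lemma IsIrreducibleCharacter.exists_link (hχ : IsIrreducibleCharacter χ) {X₁ Y₁ X₂ Y₂ : C}
    {α₁ : X₁ ⟶ Y₁} {α₂ : X₂ ⟶ Y₂} (h₁ : morphismValue χ α₁ ≠ 0) (h₂ : morphismValue χ α₂ ≠ 0) :
    ∃ (A P : C) (γ : A ⟶ P), morphismValue χ γ ≠ 0 ∧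
      ∀ M : C, (∃ g : A ⟶ M, ¬ Factors g γ) →
        (∃ g : X₁ ⟶ M, ¬ Factors g α₁) ∧ ∃ g : X₂ ⟶ M, ¬ Factors g α₂ := by
  have hc := hχ.isCharacter
  let T : C → Prop := fun M ↦ ∀ f : X₁ ⟶ M, Factors f α₁
  have hle := vanishingPart_le (T := T) hc
  -- F_{α₁} vanishes on `T`, so its whole value counts; by irreducibility the vanishing part is then
  -- all of χ.
  have h1 : vanishingPart χ T ≠ 0 := fun h0 ↦ by
    have := (ChainValue.agree (χ := χ) (T := T) α₁ (𝟙 X₁) (Factors.of_id _)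
      fun M hM g _ ↦ hM g).le_mass hc
    rw [← value_vanishingPart hc, h0, hc.value_id] at this
    have h2 := hc.value_nonneg α₁
    simp only [morphismValue, Pi.zero_apply] at this h₁ h2
    omega
  have h2 : (fun X ↦ χ X - vanishingPart χ T X) = 0 :=
    (hχ.eq_zero_or_eq_zero _ _ (isCharacter_vanishingPart hc)
      (isCharacter_sub_vanishingPart hc)
      (by ext X; exact (Nat.add_sub_of_le (hle X)).symm)).resolve_left h1
  have h3 : vanishingPart χ T = χ := by
    ext X
    have := congrFun h2 X
    have := hle X
    simp only [Pi.zero_apply] at *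
    omega
  have h4 := value_vanishingPart (T := T) hc α₂
  rw [h3] at h4
  -- Thus F_{α₂} has positive mass, and some subquotient im a / im b of it vanishes on `T` and has
  -- positive value.
  obtain ⟨B, A, b, a, hb, hba, hT, hpos⟩ :=
    (chainValue_mass (T := T) hc (Factors.of_id α₂)).exists_agreeOn
      (by have := hc.value_nonneg α₂; omega)
  refine ⟨_, _, relPushout b a, by rw [hc.value_relPushout hba]; omega, ?_⟩
  rintro M ⟨g, hg⟩
  rw [factors_relPushout_iff] at hg
  refine ⟨?_, a ≫ g, fun h ↦ hg (h.trans hb)⟩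
  by_contra! hM
  exact hg (hT M hM _ ⟨g, rfl⟩)

end Intervals

/-! ### Isolated points and left almost split morphisms. -/

section Isolated

variable {C : Type u} [Category.{v} C] [Abelian C]

lemma morphismValue_add (χ₁ χ₂ : C → ℕ) {X Y : C} (α : X ⟶ Y) :
    morphismValue (χ₁ + χ₂) α = morphismValue χ₁ α + morphismValue χ₂ α := by
  simp only [morphismValue, Pi.add_apply]
  push_cast
  ring

lemma IsCharacter.eq_zero_of_value_eq_zero {χ : C → ℕ} (hχ : IsCharacter χ)
    (h : ∀ {X Y : C} (α : X ⟶ Y), morphismValue χ α = 0) : χ = 0 := by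
  ext X
  have := h (0 : X ⟶ 0)
  rw [hχ.value_zero] at this
  exact_mod_cast this

lemma IsCharacter.sub {χ ψ : C → ℕ} (hχ : IsCharacter χ) (hψ : IsCharacter ψ)
    (h : ∀ {X Y : C} (α : X ⟶ Y), morphismValue χ α ≤ morphismValue ψ α) :
    IsCharacter (fun X ↦ ψ X - χ X) ∧ ψ = χ + fun X ↦ ψ X - χ X := by
  have hle (X : C) : χ X ≤ ψ X := by
    have := h (0 : X ⟶ 0)
    rw [hχ.value_zero, hψ.value_zero] at this
    exact_mod_cast this
  refine ⟨.of_value_nonneg (fun X Y ↦ ?_) (fun e ↦ ?_) fun {X Y} α ↦ ?_, ?_⟩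
  · have := hle X
    have := hle Y
    rw [hχ.biprod, hψ.biprod]
    omega
  · rw [hχ.map_iso e, hψ.map_iso e]
  · have := hle X
    have := hle Y
    have := hle (cokernel α)
    have := h α
    simp only [morphismValue] at this ⊢
    omega
  · ext X
    exact (Nat.add_sub_of_le (hle X)).symm

lemma IsIrreducibleCharacter.eq_of_value_le {χ ψ : C → ℕ} (hχ : IsCharacter χ) (h0 : χ ≠ 0)
    (hψ : IsIrreducibleCharacter ψ)
    (h : ∀ {X Y : C} (α : X ⟶ Y), morphismValue χ α ≤ morphismValue ψ α) : ψ = χ := by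
  obtain ⟨h1, h2⟩ := hχ.sub hψ.isCharacter h
  have h3 := (hψ.eq_zero_or_eq_zero _ _ hχ h1 h2).resolve_left h0
  rw [h3, add_zero] at h2
  exact h2

/-- A character bounded by the one of `M` vanishes if it vanishes at a morphism whose functor is
supported at the top of `M`. -/
lemma eq_zero_of_le_natCharacter (hfin : ∀ M X : C, objectCharacter M X ≠ ⊤) {M N : C}
    {φ : M ⟶ N} (hφ : ∀ b : N ⟶ M, Factors (𝟙 M) (𝟙 M - φ ≫ b)) {ψ : C → ℕ} (hψ : IsCharacter ψ)
    (hle : ∀ {X Y : C} (α : X ⟶ Y), morphismValue ψ α ≤ morphismValue (natCharacter M) α)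
    (h0 : morphismValue ψ φ = 0) : ψ = 0 := by
  have hM := isCharacter_natCharacter hfin M
  suffices key : ∀ (n : ℕ) {X Y : C} (α : X ⟶ Y), morphismValue (natCharacter M) α ≤ n →
      morphismValue ψ α = 0 by
    refine hψ.eq_zero_of_value_eq_zero fun α ↦ key (morphismValue (natCharacter M) α).toNat α ?_
    exact Int.self_le_toNat _
  intro n
  induction n with
  | zero =>
    intro X Y α hα
    have := hle α
    have := hψ.value_nonneg α
    simp only [Nat.cast_zero] at hα
    omega
  | succ n ih =>
    intro X Y α hα
    by_cases h : morphismValue (natCharacter M) α = 0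
    · have := hle α
      have := hψ.value_nonneg α
      omega
    obtain ⟨f, hf⟩ := (morphismValue_natCharacter_ne_zero_iff hfin M α).1 h
    obtain ⟨_, _, _, α', β, β', hβ, hφβ, hsum⟩ := devissage hφ hf
    -- The piece at `β` has positive χ_M-value, so the induction covers `α'` and `β'`, while ψ(β) ≤
    -- ψ(φ) = 0.
    have h1 := (morphismValue_natCharacter_ne_zero_iff hfin M β).2 ⟨𝟙 M, hβ⟩
    have h2 := hM.value_nonneg β
    have h3 := hM.value_nonneg α'
    have h4 := hM.value_nonneg β'
    have h5 := hsum _ hM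
    have h6 := hψ.value_antitone hφβ
    have h7 := hψ.value_nonneg β
    push_cast at hα
    rw [hsum ψ hψ, ih α' (by omega), ih β' (by omega)]
    omega

/-- For `φ` absorbing the radical of `End M` the value is 1, so one summand vanishes at `φ` and
hence everywhere. -/
lemma IsLocalObject.isIrreducibleCharacter {k : Type*} [CommRing k] [Linear k C]
    (hhom : ∀ X Y : C, IsFiniteLength k (X ⟶ Y)) {M : C} (hM : IsLocalObject M) :
    IsIrreducibleCharacter (natCharacter M) := by
  have hfin : ∀ M X : C, objectCharacter M X ≠ ⊤ := objectCharacter_ne_top hhom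
  have hc := isCharacter_natCharacter hfin M
  obtain ⟨N, φ, h1, -, h2⟩ := hM.exists_radical_approximation hhom (hM.not_factors_zero M) M
  have hone : morphismValue (natCharacter M) φ = 1 :=
    morphismValue_natCharacter_eq_one hfin φ ⟨𝟙 M, h1⟩ fun f hf ↦ by
      by_contra h
      exact hf (h2 f h)
  refine ⟨hc, fun h ↦ ?_, fun χ₁ χ₂ hχ₁ hχ₂ h ↦ ?_⟩
  · rw [h] at hone
    simp [morphismValue] at hone
  · have hv {X Y : C} (α : X ⟶ Y) : morphismValue (natCharacter M) α =
        morphismValue χ₁ α + morphismValue χ₂ α := by rw [h, morphismValue_add]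
    have h₁ := hχ₁.value_nonneg φ
    have h₂ := hχ₂.value_nonneg φ
    have h₃ := hv φ
    rcases (by omega : morphismValue χ₁ φ = 0 ∨ morphismValue χ₂ φ = 0) with h0 | h0
    · refine .inl (eq_zero_of_le_natCharacter hfin (hM.factors_one_sub h1) hχ₁ (fun α ↦ ?_) h0)
      have := hχ₂.value_nonneg α
      have := hv α
      omega
    · refine .inr (eq_zero_of_le_natCharacter hfin (hM.factors_one_sub h1) hχ₂ (fun α ↦ ?_) h0)
      have := hχ₁.value_nonneg α
      have := hv α
      omega

lemma IsLeftAlmostSplit.not_factors {M N : C} {φ : M ⟶ N} (hφ : IsLeftAlmostSplit φ) :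
    ¬ Factors (𝟙 M) φ := fun h ↦ hφ.1 ((isSplitMono_iff_factors φ).2 h)

lemma IsLeftAlmostSplit.factors {M N : C} {φ : M ⟶ N} (hφ : IsLeftAlmostSplit φ) {Z : C}
    {f : M ⟶ Z} (hf : ¬ Factors (𝟙 M) f) : Factors f φ :=
  hφ.2 Z f fun h ↦ hf ((isSplitMono_iff_factors f).1 h)

lemma IsLeftAlmostSplit.factors_one_sub {M N : C} {φ : M ⟶ N} (hφ : IsLeftAlmostSplit φ)
    (b : N ⟶ M) : Factors (𝟙 M) (𝟙 M - φ ≫ b) := by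
  by_contra h
  have := (hφ.factors h).add ⟨b, rfl⟩
  rw [sub_add_cancel] at this
  exact hφ.not_factors this

/-- The basic open set given by a left almost split morphism is a single point. -/
lemma IsLeftAlmostSplit.eq_natCharacter (hfin : ∀ M X : C, objectCharacter M X ≠ ⊤) {M N : C}
    {φ : M ⟶ N} (hφ : IsLeftAlmostSplit φ) {ψ : C → ℕ} (hψ : IsIrreducibleCharacter ψ)
    (h0 : morphismValue ψ φ ≠ 0) : ψ = natCharacter M := by
  have hM := isCharacter_natCharacter hfin M
  have hψ' := hψ.isCharacter
  have hone : morphismValue (natCharacter M) φ = 1 :=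
    morphismValue_natCharacter_eq_one hfin φ ⟨𝟙 M, hφ.not_factors⟩ fun f hf ↦ by
      by_contra h
      exact hf (hφ.factors h)
  have hne : natCharacter M ≠ 0 := fun h ↦ by
    rw [h] at hone
    simp [morphismValue] at hone
  suffices key : ∀ (n : ℕ) {X Y : C} (α : X ⟶ Y), morphismValue (natCharacter M) α ≤ n →
      morphismValue (natCharacter M) α ≤ morphismValue ψ α by
    refine IsIrreducibleCharacter.eq_of_value_le hM hne hψ fun α ↦
      key (morphismValue (natCharacter M) α).toNat α ?_
    exact Int.self_le_toNat _
  intro n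
  induction n with
  | zero =>
    intro X Y α hα
    have := hψ'.value_nonneg α
    simp only [Nat.cast_zero] at hα
    omega
  | succ n ih =>
    intro X Y α hα
    by_cases h : morphismValue (natCharacter M) α = 0
    · have := hψ'.value_nonneg α
      omega
    obtain ⟨f, hf⟩ := (morphismValue_natCharacter_ne_zero_iff hfin M α).1 h
    obtain ⟨_, _, _, α', β, β', hβ, hφβ, hsum⟩ := devissage hφ.factors_one_sub hf
    -- `β` and `φ` factor through each other, so this piece contributes 1 to χ_M and at least 1 to
    -- ψ.
    have h1 := hM.value_congr hφβ (hφ.factors hβ)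
    have h2 := hψ'.value_congr hφβ (hφ.factors hβ)
    have h3 := hM.value_nonneg α'
    have h4 := hM.value_nonneg β'
    have h5 := hψ'.value_nonneg φ
    have h6 := hsum _ hM
    have h7 := hsum _ hψ'
    push_cast at hα
    have h8 := ih α' (by omega)
    have h9 := ih β' (by omega)
    omega

/-- An irreducible character in finitely many basic open sets lies in one basic open set of which
all points coming from objects of `C` are in the given ones. -/
lemma Sp.exists_refinement (χ : Sp C) (s : Set (Set (Sp C))) (hs : s.Finite)
    (hsub : s ⊆ {U | ∃ (X Y : C) (α : X ⟶ Y), U = basicOpen α}) (hmem : χ ∈ ⋂₀ s)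
    (hfin : ∀ M X : C, objectCharacter M X ≠ ⊤) :
    ∃ (A P : C) (γ : A ⟶ P), morphismValue χ.toFun γ ≠ 0 ∧
      ∀ M : C, (∃ g : A ⟶ M, ¬ Factors g γ) → ∀ ψ : Sp C, ψ.toFun = natCharacter M →
        ψ ∈ ⋂₀ s := by
  induction s, hs using Set.Finite.induction_on with
  | empty =>
    obtain ⟨X, hX⟩ := Function.ne_iff.1 χ.isIrreducible.ne_zero
    refine ⟨X, 0, 0, ?_, by simp⟩
    rw [χ.isIrreducible.isCharacter.value_zero]
    exact_mod_cast hX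
  | @insert U s _ _ ih =>
    rw [Set.sInter_insert] at hmem
    obtain ⟨A, P, γ, hγ, h⟩ := ih ((Set.subset_insert _ _).trans hsub) hmem.2
    obtain ⟨X, Y, α, rfl⟩ := hsub (Set.mem_insert _ _)
    obtain ⟨A', P', γ', hγ', h'⟩ := χ.isIrreducible.exists_link hγ hmem.1
    refine ⟨A', P', γ', hγ', fun M hM ψ hψ ↦ ?_⟩
    rw [Set.sInter_insert]
    refine ⟨?_, h M (h' M hM).1 ψ hψ⟩
    change morphismValue ψ.toFun α ≠ 0
    rw [hψ, morphismValue_natCharacter_ne_zero_iff hfin]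
    exact (h' M hM).2

variable {k : Type*} [CommRing k] [Linear k C]

/-- Factoring through `γ` can be tested on the local summands of the target. -/
lemma exists_isLocalObject_not_factors (hhom : ∀ X Y : C, IsFiniteLength k (X ⟶ Y)) {A P Z : C}
    {γ : A ⟶ P} {g : A ⟶ Z} (hg : ¬ Factors g γ) :
    ∃ M : C, IsLocalObject M ∧ ∃ g : A ⟶ M, ¬ Factors g γ := by
  by_contra! h
  refine hg (local_induction hhom (p := fun Z ↦ ∀ g : A ⟶ Z, Factors g γ) ?_ h ?_ Z g)
  · intro X hX g
    rw [← Category.comp_id g, hX, comp_zero]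
    exact Factors.zero _
  · intro X Y Z e hY hZ g
    obtain ⟨w, hw⟩ := (hY (g ≫ e.hom ≫ biprod.fst)).lift (hZ (g ≫ e.hom ≫ biprod.snd))
    refine ⟨w ≫ e.inv, ?_⟩
    rw [← Category.assoc, hw, Iso.comp_inv_eq]
    ext <;> simp

/-- `β` already handles local targets not isomorphic to M; the radical of `End M` handles M itself.
-/
lemma IsLocalObject.exists_isLeftAlmostSplit (hhom : ∀ X Y : C, IsFiniteLength k (X ⟶ Y)) {M P : C}
    (hM : IsLocalObject M) {β : M ⟶ P} (hβ : ¬ Factors (𝟙 M) β)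
    (h : ∀ M' : C, IsLocalObject M' → (∃ g : M ⟶ M', ¬ Factors g β) → Nonempty (M' ≅ M)) :
    ∃ (N : C) (φ : M ⟶ N), IsLeftAlmostSplit φ := by
  obtain ⟨N, φ, h1, h2, h3⟩ := hM.exists_radical_approximation hhom hβ M
  refine ⟨N, φ, fun hs ↦ h1 ((isSplitMono_iff_factors φ).1 hs), fun Z f hf ↦ ?_⟩
  rw [isSplitMono_iff_factors] at hf
  refine local_induction hhom
    (p := fun Z ↦ ∀ f : M ⟶ Z, ¬ Factors (𝟙 M) f → Factors f φ) ?_ ?_ ?_ Z f hf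
  · intro X hX g _
    rw [← Category.comp_id g, hX, comp_zero]
    exact Factors.zero _
  · intro M' hM' g hg
    by_cases hgβ : Factors g β
    · exact hgβ.trans h2
    obtain ⟨e⟩ := h M' hM' ⟨g, hgβ⟩
    have := (h3 (g ≫ e.hom) fun h ↦ hg (h.trans ⟨e.hom, rfl⟩)).comp e.inv
    simpa using this
  · intro X Y Z e hY hZ g hg
    have aux {W : C} (c : X ⟶ W) : ¬ Factors (𝟙 M) (g ≫ c) := fun h ↦ hg (h.trans ⟨c, rfl⟩)
    obtain ⟨w, hw⟩ := (hY (g ≫ e.hom ≫ biprod.fst) (aux _)).lift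
      (hZ (g ≫ e.hom ≫ biprod.snd) (aux _))
    refine ⟨w ≫ e.inv, ?_⟩
    rw [← Category.assoc, hw, Iso.comp_inv_eq]
    ext <;> simp

end Isolated

end LengthCategory

/-! ### The main theorem. -/

theorem mainTheorem7 {k : Type*} [CommRing k] {C : Type u} [Category.{v} C] [Abelian C]
    [Linear k C]
    (hlength : ∀ X : C, IsNoetherianObject X ∧ IsArtinianObject X)
    (hhom : ∀ X Y : C, IsFiniteLength k (X ⟶ Y))
    (hsimple : ∃ s : Finset C, ∀ S : C, Simple S → ∃ T ∈ s, Nonempty (S ≅ T))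
    (χ : LengthCategory.Sp C) :
    IsOpen ({χ} : Set (LengthCategory.Sp C)) ↔
      ∃ (M N : C) (φ : M ⟶ N), LengthCategory.IsLeftAlmostSplit φ ∧
        ∀ X : C, (χ.toFun X : ℕ∞) = LengthCategory.objectCharacter M X := by
  open LengthCategory in
  have hfin : ∀ M X : C, objectCharacter M X ≠ ⊤ := objectCharacter_ne_top hhom
  constructor
  · intro hopen
    obtain ⟨_, ⟨s, ⟨hs, hsub⟩, rfl⟩, hmem, hle⟩ :=
      (TopologicalSpace.isTopologicalBasis_of_subbasis rfl).exists_subset_of_mem_open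
        (Set.mem_singleton χ) hopen
    obtain ⟨A, P, γ, hγ, h⟩ := χ.exists_refinement s hs hsub hmem hfin
    have hχ (M : C) (hM : IsLocalObject M) (hg : ∃ g : A ⟶ M, ¬ Factors g γ) :
        natCharacter M = χ.toFun :=
      congrArg Sp.toFun (hle (h M hg ⟨_, hM.isIrreducibleCharacter hhom⟩ rfl))
    -- F_γ is non-zero at A itself, hence at some local object.
    have hid : ¬ Factors (𝟙 A) γ := fun hA ↦
      hγ (χ.isIrreducible.isCharacter.value_eq_zero_of_isSplitMono γ hA)
    obtain ⟨M, hM, f, hf⟩ := exists_isLocalObject_not_factors hhom hid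
    obtain ⟨N, φ, hφ⟩ := hM.exists_isLeftAlmostSplit hhom (β := relPushout γ f)
      (by rwa [factors_relPushout_iff, Category.comp_id]) fun M' hM' ⟨g, hg⟩ ↦ by
        rw [factors_relPushout_iff] at hg
        exact hM'.nonempty_iso_of_character hhom hM
          ((hχ M' hM' ⟨_, hg⟩).trans (hχ M hM ⟨f, hf⟩).symm)
    exact ⟨M, N, φ, hφ, fun X ↦ by rw [← hχ M hM ⟨f, hf⟩, coe_natCharacter hfin]⟩
  · rintro ⟨M, N, φ, hφ, hχ⟩
    have hχ' : χ.toFun = natCharacter M := by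
      ext X
      have := hχ X
      rw [← coe_natCharacter hfin] at this
      exact_mod_cast this
    have : ({χ} : Set (Sp C)) = basicOpen φ := by
      ext ψ
      constructor
      · rintro rfl
        change morphismValue ψ.toFun φ ≠ 0
        rw [hχ', morphismValue_natCharacter_ne_zero_iff hfin]
        exact ⟨𝟙 M, hφ.not_factors⟩
      · intro hψ
        exact Sp.ext ((hφ.eq_natCharacter hfin ψ.isIrreducible hψ).trans hχ'.symm)
    rw [this]
    exact TopologicalSpace.isOpen_generateFrom_of_mem ⟨M, N, φ, rfl⟩
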